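/- For $\beta>0$ let $\xi(x)=(1+|x|)^{-(1+\beta)}$. Let $\{\phi_{k,j}: k\ge 0,\ 1\le j\le 2^k\}$ be real functions in $L^2(\mathbb R)\cap L^\infty(\mathbb R)$, not necessarily orthogonal, forming a wavelet-type system on $(0,1)$: for some constants $c$ and $0<\alpha,\beta\le 1$ and all such $k,j$, $$\operatorname{supp}\phi_{k,j}\subset[0,1],\qquad \int_{\mathbb R}\phi_{k,j}(t)\,dt=0,\qquad |\phi_{k,j}(t)|\le c\,2^{k/2}\,\xi(2^kt-j)\quad (t\in[0,1]),$$ $$|\phi_{k,j}(t)-\phi_{k,j}(t')|\le c\,2^{k/2}\,(2^k|t-t'|)^{\alpha}\,\xi(2^kt-j)\quad (t,t'\in[0,1],\ |t-t'|\le 2^{-k}).$$ Suppose that $\|\phi_{k,j}\|_{L^2}=1$ for all $k,j$, and order the system naturally: $\phi_n=\phi_{k,j}$ for $n=2^k+j$, $k\ge0$, $1\le j\le 2^k$, so that $n=2,3,\dots$. Let $w(1)\le w(2)\le\cdots$ be a nondecreasing sequence of positive numbers. Then $w$ is an a.e. unconditional convergence Weyl multiplier for $\{\phi_n\}_{n\ge2}$,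 that is, for all real coefficients with $\sum_{n\ge2}a_n^2w(n)<\infty$ the series $\sum_{n\ge2}a_n\phi_n(x)$ converges for a.e. $x\in(0,1)$ after any rearrangement of its terms, if and only if $$\sum_{n=1}^\infty\frac1{n\,w(n)}<\infty .$$ -/

import Mathlib

open MeasureTheory Filter Topology

noncomputable section

/-- The localization weight `ξ(x) = (1 + |x|)^{-(1+β)}`. -/
def waveletWeight (β x : ℝ) : ℝ := 1 / (1 + |x|) ^ (1 + β)

/-- `Φ k j`, for `k = 0, 1, 2, …` and `1 ≤ j ≤ 2 ^ k`, is a wavelet-type system on the interval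
`(0,1)` with constant `c`, smoothness exponent `α` and decay exponent `β`.  The values of `Φ k j`
for the other pairs `(k, j)` are irrelevant.  Orthogonality is not required. -/
structure IsWaveletTypeSystem (c α β : ℝ) (Φ : ℕ → ℕ → ℝ → ℝ) : Prop where
  alpha_pos : 0 < α
  alpha_le_one : α ≤ 1
  beta_pos : 0 < β
  beta_le_one : β ≤ 1
  memLp_two : ∀ k j : ℕ, 1 ≤ j → j ≤ 2 ^ k → MemLp (Φ k j) 2 volume
  memLp_top : ∀ k j : ℕ, 1 ≤ j → j ≤ 2 ^ k → MemLp (Φ k j) ⊤ volume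
  support_subset : ∀ k j : ℕ, 1 ≤ j → j ≤ 2 ^ k → Function.support (Φ k j) ⊆ Set.Icc 0 1
  integral_eq_zero : ∀ k j : ℕ, 1 ≤ j → j ≤ 2 ^ k → ∫ t, Φ k j t = 0
  abs_le : ∀ k j : ℕ, 1 ≤ j → j ≤ 2 ^ k → ∀ t ∈ Set.Icc (0 : ℝ) 1,
    |Φ k j t| ≤ c * (2 : ℝ) ^ ((k : ℝ) / 2) * waveletWeight β ((2 : ℝ) ^ k * t - j)
  /-- Hölder condition at scale `2 ^ (-k)`. (Without the restriction `|t - t'| ≤ 2 ^ (-k)`, no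
  normalized system on `(0,1)` could satisfy it, because the weight decays faster than
  `|t - t'| ^ α` grows.) -/
  holder : ∀ k j : ℕ, 1 ≤ j → j ≤ 2 ^ k →
    ∀ t ∈ Set.Icc (0 : ℝ) 1, ∀ t' ∈ Set.Icc (0 : ℝ) 1, |t - t'| ≤ 1 / (2 : ℝ) ^ k →
      |Φ k j t - Φ k j t'| ≤ c * (2 : ℝ) ^ ((k : ℝ) / 2) * ((2 : ℝ) ^ k * |t - t'|) ^ α
        * waveletWeight β ((2 : ℝ) ^ k * t - j)

/-- Every function of the system has `L²`-norm one. -/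
def IsL2Normalized (Φ : ℕ → ℕ → ℝ → ℝ) : Prop :=
  ∀ k j : ℕ, 1 ≤ j → j ≤ 2 ^ k → eLpNorm (Φ k j) 2 volume = 1

/-- The natural ordering of a system on `(0,1)`: for `n ≥ 2`, write `n = 2 ^ k + j` with
`1 ≤ j ≤ 2 ^ k`; the `n`-th function is `Φ k j`.  (The values at `n = 0, 1` are not used.) -/
def naturalOrdering (Φ : ℕ → ℕ → ℝ → ℝ) (n : ℕ) : ℝ → ℝ :=
  Φ (Nat.log 2 (n - 1)) (n - 2 ^ Nat.log 2 (n - 1))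

/-- The defining property of the natural ordering. -/
theorem naturalOrdering_two_pow_add (Φ : ℕ → ℕ → ℝ → ℝ) (k j : ℕ) (hj : 1 ≤ j)
    (hjk : j ≤ 2 ^ k) : naturalOrdering Φ (2 ^ k + j) = Φ k j := by
  have h : Nat.log 2 (2 ^ k + j - 1) = k := by
    apply Nat.log_eq_of_pow_le_of_lt_pow
    · omega
    · rw [pow_succ]; omega
  unfold naturalOrdering
  rw [h, Nat.add_sub_cancel_left]

/-- `w` is an a.e. unconditional convergence Weyl multiplier on `E` for the system `φ n`, `n ∈ I`
(with `I` an infinite set of indices): whenever `∑_{n ∈ I} a n ^ 2 * w n < ∞`, the series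
`∑_{n ∈ I} a n * φ n x`, arranged in any order `σ`, converges for almost every `x ∈ E`. The
exceptional null set may depend on the coefficients and on the order. -/
def IsUCMultiplier (I : Set ℕ) (E : Set ℝ) (φ : ℕ → ℝ → ℝ) (w : ℕ → ℝ) : Prop :=
  ∀ a : ℕ → ℝ, Summable (fun n : I => a n ^ 2 * w n) →
    ∀ σ : ℕ ≃ I, ∀ᵐ x ∂(volume.restrict E), ∃ s : ℝ,
      Tendsto (fun N : ℕ => ∑ i ∈ Finset.range N, a (σ i) * φ (σ i) x) atTop (𝓝 s)

end

/-!
Write `φ n = Φ k j` for `n = 2 ^ k + j`. The decay of `Φ k j` gives `‖Φ k j‖₁ ≲ 2 ^ (-k / 2)`, that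
is `‖φ n‖₁ ≲ n ^ (-1 / 2)`, so when `∑ 1 / (n w n)` converges the Cauchy–Schwarz inequality gives
`∑ |a n| ‖φ n‖₁ < ∞`, and the series converges absolutely almost everywhere
(`IsWaveletTypeSystem.isUCMultiplier_of_summable`).

For the converse, the normalization `‖Φ k j‖₂ = 1` and the Hölder condition provide a point `y` and
a sign `s`, depending on `k` and `j`, with `s * ∫ t in Ioi y, Φ k j t ≥ κ 2 ^ (-k / 2)`
(`IsWaveletTypeSystem.exists_le_integral_Ioi`). If `∑ 1 / (n w n)` diverges, the Abel–Dini argument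
(`exists_weighted_square_summable_of_not_summable`) yields `b k > 0` with
`∑ b k ^ 2 w (2 ^ (k + 1)) < ∞` and `∑ b k = ∞`. Take the coefficients `s * b k * 2 ^ (-k / 2)`,
cut the levels into consecutive finite blocks over each of which `b` has sum at least `1 / 2`, and
inside each block arrange the functions in the order of increasing `y`. For every `x`, the terms of
a block with `y < x` are then consecutive, so their sum `T x` is a difference of two partial sums
of the rearranged series. With `S` the sum of `b` over the block, `|T| ≤ C S` because
`∑ j, |Φ k j x| ≲ 2 ^ (k / 2)`, while `∫ T ≥ κ S` by the choice of `y` and `s`. Almost everywhere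
convergence would make `T / S` tend to zero boundedly along the blocks, contradicting the lower
bound of the integrals.
-/

/-! ### Sums and integrals of the localization weight -/

lemma waveletWeight_nonneg (β x : ℝ) : 0 ≤ waveletWeight β x := by
  unfold waveletWeight; positivity

lemma waveletWeight_le_one {β : ℝ} (hβ : 0 < β) (x : ℝ) : waveletWeight β x ≤ 1 := by
  unfold waveletWeight
  have h : (1 : ℝ) ≤ (1 + |x|) ^ (1 + β) :=
    Real.one_le_rpow (by linarith [abs_nonneg x]) (by linarith)
  exact (div_le_one (by linarith)).2 h

lemma integrable_waveletWeight {β : ℝ} (hβ : 0 < β) : Integrable (waveletWeight β) := by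
  have h := integrable_one_add_norm (E := ℝ) (μ := volume) (r := 1 + β) (by simp; linarith)
  refine h.congr (Eventually.of_forall fun x => ?_)
  have : (0 : ℝ) ≤ 1 + |x| := by positivity
  simp only [waveletWeight, Real.norm_eq_abs]
  rw [Real.rpow_neg this, one_div]

lemma integrable_waveletWeight_comp {β : ℝ} (hβ : 0 < β) (k : ℕ) (u : ℝ) :
    Integrable (fun t => waveletWeight β ((2 : ℝ) ^ k * t - u)) :=
  ((integrable_waveletWeight hβ).comp_sub_right u).comp_mul_left' (by positivity)

lemma integral_waveletWeight_comp (β : ℝ) (k : ℕ) (u : ℝ) :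
    ∫ t, waveletWeight β ((2 : ℝ) ^ k * t - u) = ((2 : ℝ) ^ k)⁻¹ * ∫ t, waveletWeight β t := by
  rw [Measure.integral_comp_mul_left (fun v => waveletWeight β (v - u)),
    integral_sub_right_eq_self (waveletWeight β) u, smul_eq_mul, abs_of_pos (by positivity)]

lemma summable_waveletWeight_int {β : ℝ} (hβ : 0 < β) :
    Summable (fun n : ℤ => waveletWeight β n) := by
  have h : Summable (fun n : ℕ => waveletWeight β n) := by
    have h1 := (summable_nat_add_iff 1).2 (Real.summable_one_div_nat_rpow.2 (by linarith : 1 < 1 + β))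
    refine h1.congr fun n => ?_
    simp [waveletWeight, add_comm]
  refine Summable.of_nat_of_neg (by simpa using h) ?_
  refine h.congr fun n => ?_
  simp [waveletWeight]

/-- The translates of the weight by distinct integers have a bounded sum, since `ξ (u - j)` is
comparable with `ξ (⌊u⌋ - j)`. -/
lemma exists_sum_waveletWeight_le {β : ℝ} (hβ : 0 < β) :
    ∃ C : ℝ, 0 < C ∧ ∀ (u : ℝ) (K : ℕ),
      ∑ m ∈ Finset.range K, waveletWeight β (u - (m + 1 : ℕ)) ≤ C := by
  have hs := summable_waveletWeight_int hβ
  have h0 : 0 ≤ ∑' n : ℤ, waveletWeight β n := tsum_nonneg fun n => waveletWeight_nonneg β n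
  refine ⟨(2 : ℝ) ^ (1 + β) * (∑' n : ℤ, waveletWeight β n) + 1, by positivity, fun u K => ?_⟩
  have hinj : Function.Injective (fun m : ℕ => ⌊u⌋ - ((m + 1 : ℕ) : ℤ)) := by
    intro a b hab
    simp only at hab
    omega
  have hterm : ∀ m : ℕ, waveletWeight β (u - (m + 1 : ℕ)) ≤
      (2 : ℝ) ^ (1 + β) * waveletWeight β ((⌊u⌋ - ((m + 1 : ℕ) : ℤ) : ℤ) : ℝ) := by
    intro m
    set z : ℝ := ((⌊u⌋ - ((m + 1 : ℕ) : ℤ) : ℤ) : ℝ) with hz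
    have hz' : z = ⌊u⌋ - ((m + 1 : ℕ) : ℝ) := by rw [hz]; push_cast; ring
    have h1 : |z| ≤ |u - (m + 1 : ℕ)| + 1 := by
      have e : z = (u - (m + 1 : ℕ)) + (⌊u⌋ - u) := by rw [hz']; ring
      rw [e]
      refine (abs_add_le _ _).trans (add_le_add_right ?_ _)
      rw [abs_le]
      constructor <;> linarith [Int.floor_le u, Int.lt_floor_add_one u]
    have h2 : 1 + |z| ≤ 2 * (1 + |u - (m + 1 : ℕ)|) := by
      linarith [abs_nonneg (u - (m + 1 : ℕ))]
    have h3 := Real.rpow_le_rpow (by positivity) h2 (by linarith : (0 : ℝ) ≤ 1 + β)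
    rw [Real.mul_rpow (by norm_num) (by positivity)] at h3
    unfold waveletWeight
    rw [mul_one_div, div_le_div_iff₀ (by positivity) (by positivity)]
    linarith
  calc ∑ m ∈ Finset.range K, waveletWeight β (u - (m + 1 : ℕ))
      ≤ ∑ m ∈ Finset.range K,
          (2 : ℝ) ^ (1 + β) * waveletWeight β ((⌊u⌋ - ((m + 1 : ℕ) : ℤ) : ℤ) : ℝ) :=
        Finset.sum_le_sum fun m _ => hterm m
    _ = (2 : ℝ) ^ (1 + β) * ∑ m ∈ Finset.range K,
          waveletWeight β ((⌊u⌋ - ((m + 1 : ℕ) : ℤ) : ℤ) : ℝ) := by rw [Finset.mul_sum]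
    _ ≤ (2 : ℝ) ^ (1 + β) * ∑' n : ℤ, waveletWeight β n := by
        refine mul_le_mul_of_nonneg_left ?_ (by positivity)
        have := hs.sum_le_tsum ((Finset.range K).map ⟨_, hinj⟩)
          (fun n _ => waveletWeight_nonneg β n)
        simpa only [Finset.sum_map, Function.Embedding.coeFn_mk] using this
    _ ≤ _ := by linarith

/-! ### Divergent series -/

/-- Abel–Dini: if `∑ v k` diverges then, with `S k` its partial sums, `b k = v k / S k` still has a
divergent sum although `∑ b k ^ 2 / v k = ∑ v k / S k ^ 2` converges by telescoping. -/
lemma exists_weighted_square_summable_of_not_summable {v : ℕ → ℝ} (hv : ∀ k, 0 < v k)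
    (hns : ¬ Summable v) :
    ∃ b : ℕ → ℝ, (∀ k, 0 < b k) ∧ Summable (fun k => b k ^ 2 / v k) ∧
      ∀ m, ∃ n, m < n ∧ 1 / 2 ≤ ∑ k ∈ Finset.Ico m n, b k := by
  set S : ℕ → ℝ := fun k => ∑ i ∈ Finset.range (k + 1), v i with hS
  have hSs : ∀ k, S (k + 1) = S k + v (k + 1) := fun k => Finset.sum_range_succ _ _
  have hSpos : ∀ k, 0 < S k := fun k => Finset.sum_pos (fun i _ => hv i) ⟨0, by simp⟩
  have hSmono : Monotone S := monotone_nat_of_le_succ fun k => by rw [hSs]; linarith [hv (k + 1)]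
  have hStop : Tendsto S atTop atTop :=
    ((not_summable_iff_tendsto_nat_atTop_of_nonneg fun k => (hv k).le).1 hns).comp
      (tendsto_add_atTop_nat 1)
  refine ⟨fun k => v k / S k, fun k => div_pos (hv k) (hSpos k), ?_, fun m => ?_⟩
  · have htel : ∀ K, ∑ k ∈ Finset.range (K + 1), (v k / S k) ^ 2 / v k ≤ 2 / v 0 - 1 / S K := by
      intro K
      induction K with
      | zero =>
        have h0 := hv 0
        simp only [hS, zero_add, Finset.sum_range_one]
        apply le_of_eq
        field_simp
        norm_num
      | succ K ih =>
        rw [Finset.sum_range_succ]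
        have h1 : (v (K + 1) / S (K + 1)) ^ 2 / v (K + 1) ≤ 1 / S K - 1 / S (K + 1) := by
          have a := hv (K + 1)
          have p := hSpos K
          have q := hSpos (K + 1)
          have e : (v (K + 1) / S (K + 1)) ^ 2 / v (K + 1)
              = v (K + 1) / (S (K + 1) * S (K + 1)) := by
            field_simp
          have e2 : 1 / S K - 1 / S (K + 1) = v (K + 1) / (S K * S (K + 1)) := by
            rw [div_sub_div _ _ p.ne' q.ne']
            congr 1
            linarith [hSs K]
          rw [e, e2]
          have := hSmono (Nat.le_succ K)
          gcongr
        linarith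
    refine summable_of_sum_range_le (c := 2 / v 0)
      (fun k => div_nonneg (sq_nonneg _) (hv k).le) fun K => ?_
    have h1 : ∑ k ∈ Finset.range K, (v k / S k) ^ 2 / v k
        ≤ ∑ k ∈ Finset.range (K + 1), (v k / S k) ^ 2 / v k := by
      rw [Finset.sum_range_succ]
      have : 0 ≤ (v K / S K) ^ 2 / v K := div_nonneg (sq_nonneg _) (hv K).le
      linarith
    have h2 := htel K
    have h3 : 0 < 1 / S K := one_div_pos.2 (hSpos K)
    linarith
  · obtain ⟨n, hmn, hn⟩ : ∃ n, m < n ∧ 2 * S m ≤ S n :=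
      ((eventually_gt_atTop m).and (hStop.eventually_ge_atTop (2 * S m))).exists
    refine ⟨n + 1, by omega, ?_⟩
    have h1 : ∑ k ∈ Finset.Ico (m + 1) (n + 1), v k = S n - S m :=
      Finset.sum_Ico_eq_sub _ (by omega)
    calc (1 : ℝ) / 2 ≤ (S n - S m) / S n := by
          rw [div_le_div_iff₀ (by norm_num) (hSpos n)]; linarith
      _ = ∑ k ∈ Finset.Ico (m + 1) (n + 1), v k / S n := by rw [← h1, Finset.sum_div]
      _ ≤ ∑ k ∈ Finset.Ico (m + 1) (n + 1), v k / S k := by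
          refine Finset.sum_le_sum fun k hk => ?_
          have hkn : k ≤ n := by have := (Finset.mem_Ico.1 hk).2; omega
          have := hSmono hkn
          have := hSpos k
          have := (hv k).le
          gcongr
      _ ≤ ∑ k ∈ Finset.Ico m (n + 1), v k / S k := by
          refine Finset.sum_le_sum_of_subset_of_nonneg ?_
            fun k _ _ => (div_pos (hv k) (hSpos k)).le
          exact Finset.Ico_subset_Ico (by omega) le_rfl

/-! ### Rearrangements that sort finite blocks -/

/-- Some permutation of `ℕ` preserves each block `[M i, M (i + 1))` and arranges it in the order
of increasing `y`. -/
lemma exists_perm_monotone_on_blocks {M : ℕ → ℕ} (hM : StrictMono M) (hM0 : M 0 = 0)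
    (y : ℕ → ℝ) :
    ∃ τ : Equiv.Perm ℕ, ∀ i,
      (∀ n, n ∈ Finset.Ico (M i) (M (i + 1)) → τ n ∈ Finset.Ico (M i) (M (i + 1))) ∧
      ∀ m n, M i ≤ m → m ≤ n → n < M (i + 1) → y (τ m) ≤ y (τ n) := by
  have hle : ∀ i, M i ≤ M (i + 1) := fun i => (hM (Nat.lt_succ_self i)).le
  let f : (Σ i, Fin (M (i + 1) - M i)) → ℕ := fun p => M p.1 + p.2
  have hf : Function.Bijective f := by
    constructor
    · rintro ⟨i, a⟩ ⟨j, b⟩ hab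
      simp only [f] at hab
      have ha := a.2
      have hb := b.2
      have hij : i = j := by
        rcases lt_trichotomy i j with h | h | h
        · have := hM.monotone (show i + 1 ≤ j from h); omega
        · exact h
        · have := hM.monotone (show j + 1 ≤ i from h); omega
      subst hij
      have : a = b := Fin.ext (by omega)
      rw [this]
    · intro n
      have hex : ∃ i, n < M (i + 1) := ⟨n, lt_of_lt_of_le (Nat.lt_succ_self n) (hM.le_apply)⟩
      classical
      have h1 := Nat.find_spec hex
      have h2 : M (Nat.find hex) ≤ n := by
        rcases hk : Nat.find hex with _ | k
        · omega
        · have := Nat.find_min hex (m := k) (by omega)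
          omega
      exact ⟨⟨Nat.find hex, ⟨n - M (Nat.find hex), by omega⟩⟩, by simp only [f]; omega⟩
  let e := Equiv.ofBijective f hf
  let s : ∀ i, Equiv.Perm (Fin (M (i + 1) - M i)) :=
    fun i => Tuple.sort (fun a : Fin (M (i + 1) - M i) => y (M i + a))
  let τ : Equiv.Perm ℕ := (e.symm.trans (Equiv.sigmaCongrRight s)).trans e
  have hτ : ∀ i (a : Fin (M (i + 1) - M i)), τ (M i + a) = M i + s i a := by
    intro i a
    have h : e.symm (M i + a) = ⟨i, a⟩ := e.symm_apply_eq.2 rfl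
    simp only [τ, Equiv.trans_apply, h]
    rfl
  refine ⟨τ, fun i => ⟨fun n hn => ?_, fun m n hm hmn hn => ?_⟩⟩
  · rw [Finset.mem_Ico] at hn ⊢
    have := hτ i ⟨n - M i, by omega⟩
    simp only [Nat.add_sub_cancel' hn.1] at this
    have h2 := (s i ⟨n - M i, by omega⟩).2
    omega
  · have h1 := hτ i ⟨m - M i, by omega⟩
    have h2 := hτ i ⟨n - M i, by omega⟩
    simp only [Nat.add_sub_cancel' hm] at h1
    simp only [Nat.add_sub_cancel' (hm.trans hmn)] at h2
    rw [h1, h2]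
    exact Tuple.monotone_sort (fun a : Fin (M (i + 1) - M i) => y (M i + a))
      (Fin.mk_le_mk.2 (by omega))

/-- After sorting by `y`, the terms of a block with `y < x` form an initial segment. -/
lemma exists_sum_Ico_comp_eq_sum_filter {p q : ℕ} (hpq : p ≤ q) {τ : Equiv.Perm ℕ} {y : ℕ → ℝ}
    (hτ : ∀ n, n ∈ Finset.Ico p q → τ n ∈ Finset.Ico p q)
    (hy : ∀ m n, p ≤ m → m ≤ n → n < q → y (τ m) ≤ y (τ n)) (x : ℝ) (g : ℕ → ℝ) :
    ∃ r, p ≤ r ∧ ∑ n ∈ Finset.Ico p r, g (τ n) =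
      ∑ n ∈ Finset.Ico p q, if y n < x then g n else 0 := by
  classical
  have himg : (Finset.Ico p q).map τ.toEmbedding = Finset.Ico p q := by
    refine Finset.eq_of_subset_of_card_le (fun n hn => ?_) (by rw [Finset.card_map])
    obtain ⟨m, hm, rfl⟩ := Finset.mem_map.1 hn
    exact hτ m hm
  have h1 : ∑ n ∈ Finset.Ico p q, (if y n < x then g n else 0) =
      ∑ n ∈ Finset.Ico p q, if y (τ n) < x then g (τ n) else 0 := by
    conv_lhs => rw [← himg]
    rw [Finset.sum_map]
    rfl
  have hex : ∃ r, p ≤ r ∧ (r = q ∨ ¬ y (τ r) < x) := ⟨q, hpq, Or.inl rfl⟩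
  have hr := Nat.find_spec hex
  have hmin : ∀ m, p ≤ m → m < Nat.find hex → m ≠ q ∧ y (τ m) < x := by
    intro m hm hlt
    have := Nat.find_min hex hlt
    tauto
  have hrq : Nat.find hex ≤ q := Nat.find_min' hex ⟨hpq, Or.inl rfl⟩
  refine ⟨Nat.find hex, hr.1, ?_⟩
  rw [h1, ← Finset.sum_Ico_consecutive _ hr.1 hrq]
  have h2 : ∑ n ∈ Finset.Ico (Nat.find hex) q, (if y (τ n) < x then g (τ n) else 0) = 0 := by
    refine Finset.sum_eq_zero fun n hn => if_neg ?_
    rw [Finset.mem_Ico] at hn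
    rcases hr.2 with h | h
    · omega
    · exact fun hlt => h ((hy _ _ hr.1 hn.1 hn.2).trans_lt hlt)
  rw [h2, add_zero]
  refine Finset.sum_congr rfl fun n hn => ?_
  rw [Finset.mem_Ico] at hn
  rw [if_pos (hmin n hn.1 hn.2).2]

/-! ### Single functions of a wavelet-type system -/

lemma two_rpow_half_sq (k : ℕ) :
    (2 : ℝ) ^ ((k : ℝ) / 2) * (2 : ℝ) ^ ((k : ℝ) / 2) = 2 ^ k := by
  rw [← Real.rpow_add (by norm_num), add_halves, Real.rpow_natCast]

namespace IsWaveletTypeSystem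

variable {c α β : ℝ} {Φ : ℕ → ℕ → ℝ → ℝ} {k j : ℕ}

lemma mono_const (h : IsWaveletTypeSystem c α β Φ) {c' : ℝ} (hc : c ≤ c') :
    IsWaveletTypeSystem c' α β Φ where
  alpha_pos := h.alpha_pos
  alpha_le_one := h.alpha_le_one
  beta_pos := h.beta_pos
  beta_le_one := h.beta_le_one
  memLp_two := h.memLp_two
  memLp_top := h.memLp_top
  support_subset := h.support_subset
  integral_eq_zero := h.integral_eq_zero
  abs_le k j hj hjk t ht := by
    have := waveletWeight_nonneg β ((2 : ℝ) ^ k * t - j)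
    exact (h.abs_le k j hj hjk t ht).trans (by gcongr)
  holder k j hj hjk t ht t' ht' htt := by
    have := waveletWeight_nonneg β ((2 : ℝ) ^ k * t - j)
    exact (h.holder k j hj hjk t ht t' ht' htt).trans (by gcongr)

lemma abs_le_univ (h : IsWaveletTypeSystem c α β Φ) (hc : 0 < c) (hj : 1 ≤ j) (hjk : j ≤ 2 ^ k)
    (t : ℝ) :
    |Φ k j t| ≤ c * (2 : ℝ) ^ ((k : ℝ) / 2) * waveletWeight β ((2 : ℝ) ^ k * t - j) := by
  by_cases ht : t ∈ Set.Icc (0 : ℝ) 1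
  · exact h.abs_le k j hj hjk t ht
  · have h0 : Φ k j t = 0 := by
      by_contra h1
      exact ht (h.support_subset k j hj hjk h1)
    rw [h0, abs_zero]
    have := waveletWeight_nonneg β ((2 : ℝ) ^ k * t - j)
    positivity

lemma integrable (h : IsWaveletTypeSystem c α β Φ) (hc : 0 < c) (hj : 1 ≤ j) (hjk : j ≤ 2 ^ k) :
    Integrable (Φ k j) := by
  refine Integrable.mono' (((integrable_waveletWeight_comp h.beta_pos k j).const_mul
    (c * (2 : ℝ) ^ ((k : ℝ) / 2)))) (h.memLp_two k j hj hjk).1 (Eventually.of_forall fun t => ?_)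
  exact h.abs_le_univ hc hj hjk t

lemma integral_abs_le (h : IsWaveletTypeSystem c α β Φ) (hc : 0 < c) (hj : 1 ≤ j)
    (hjk : j ≤ 2 ^ k) :
    ∫ t, |Φ k j t| ≤ c * (∫ t, waveletWeight β t) / (2 : ℝ) ^ ((k : ℝ) / 2) := by
  calc ∫ t, |Φ k j t|
      ≤ ∫ t, c * (2 : ℝ) ^ ((k : ℝ) / 2) * waveletWeight β ((2 : ℝ) ^ k * t - j) :=
        integral_mono (h.integrable hc hj hjk).abs
          ((integrable_waveletWeight_comp h.beta_pos k j).const_mul _)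
          (h.abs_le_univ hc hj hjk)
    _ = c * (∫ t, waveletWeight β t) / (2 : ℝ) ^ ((k : ℝ) / 2) := by
        rw [integral_const_mul, integral_waveletWeight_comp, ← two_rpow_half_sq]
        have : (0 : ℝ) < (2 : ℝ) ^ ((k : ℝ) / 2) := by positivity
        field_simp

/-- Normalization in `L²` forces a value of size comparable with `2 ^ (k / 2)`, because the
`L¹`-norm is at most of order `2 ^ (-k / 2)`. -/
lemma exists_le_abs (h : IsWaveletTypeSystem c α β Φ) (hc : 0 < c) (hn : IsL2Normalized Φ)
    (hj : 1 ≤ j) (hjk : j ≤ 2 ^ k) {A : ℝ} (hA : 0 < A)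
    (hAc : A * (c * ∫ t, waveletWeight β t) < 1) :
    ∃ t ∈ Set.Icc (0 : ℝ) 1, A * (2 : ℝ) ^ ((k : ℝ) / 2) ≤ |Φ k j t| := by
  by_contra hcon
  push Not at hcon
  have hr : (0 : ℝ) < (2 : ℝ) ^ ((k : ℝ) / 2) := by positivity
  have hlt : ∀ t, |Φ k j t| ≤ A * (2 : ℝ) ^ ((k : ℝ) / 2) := by
    intro t
    by_cases ht : t ∈ Set.Icc (0 : ℝ) 1
    · exact (hcon t ht).le
    · have h0 : Φ k j t = 0 := by
        by_contra h1
        exact ht (h.support_subset k j hj hjk h1)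
      rw [h0, abs_zero]
      positivity
  have hsq : ∫ t, Φ k j t ^ 2 = 1 := by
    have h2 := h.memLp_two k j hj hjk
    have h3 := h2.eLpNorm_eq_integral_rpow_norm (by norm_num) (by norm_num)
    rw [hn k j hj hjk] at h3
    simp only [ENNReal.toReal_ofNat, Real.rpow_ofNat, Real.norm_eq_abs, sq_abs] at h3
    have h4 := ENNReal.ofReal_eq_one.1 h3.symm
    have h5 : 0 ≤ ∫ t, Φ k j t ^ 2 := integral_nonneg fun t => sq_nonneg _
    have h6 : ((∫ t, Φ k j t ^ 2) ^ (2⁻¹ : ℝ)) ^ (2 : ℝ) = (1 : ℝ) ^ (2 : ℝ) := by rw [h4]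
    rwa [← Real.rpow_mul h5, inv_mul_cancel₀ (by norm_num), Real.rpow_one, Real.one_rpow] at h6
  have hle : ∫ t, Φ k j t ^ 2 ≤ ∫ t, A * (2 : ℝ) ^ ((k : ℝ) / 2) * |Φ k j t| := by
    refine integral_mono (h.memLp_two k j hj hjk).integrable_sq
      ((h.integrable hc hj hjk).abs.const_mul _) fun t => ?_
    show Φ k j t ^ 2 ≤ _
    rw [← sq_abs, sq]
    exact mul_le_mul_of_nonneg_right (hlt t) (abs_nonneg _)
  rw [hsq, integral_const_mul] at hle
  have := mul_le_mul_of_nonneg_left (h.integral_abs_le hc hj hjk)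
    (show 0 ≤ A * (2 : ℝ) ^ ((k : ℝ) / 2) by positivity)
  have e : A * (2 : ℝ) ^ ((k : ℝ) / 2) *
      (c * (∫ t, waveletWeight β t) / (2 : ℝ) ^ ((k : ℝ) / 2)) =
      A * (c * ∫ t, waveletWeight β t) := by
    field_simp
  linarith

/-- Around a point of near-maximal modulus the function keeps its sign on an interval of length
comparable with `2 ^ (-k)`, so the integrals over the half-lines to the right of the two ends of
that interval cannot both be small. -/
lemma exists_le_integral_Ioi (h : IsWaveletTypeSystem c α β Φ) (hc : 0 < c)
    (hn : IsL2Normalized Φ) :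
    ∃ κ : ℝ, 0 < κ ∧ ∀ k j : ℕ, 1 ≤ j → j ≤ 2 ^ k → ∃ y s : ℝ, |s| = 1 ∧
      κ / (2 : ℝ) ^ ((k : ℝ) / 2) ≤ s * ∫ t in Set.Ioi y, Φ k j t := by
  have hI : 0 ≤ ∫ t, waveletWeight β t := integral_nonneg fun t => waveletWeight_nonneg β t
  obtain ⟨A, hA, hAc⟩ : ∃ A : ℝ, 0 < A ∧ A * (c * ∫ t, waveletWeight β t) < 1 := by
    refine ⟨1 / (c * (∫ t, waveletWeight β t) + 1), by positivity, ?_⟩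
    rw [one_div_mul_eq_div, div_lt_one (by positivity)]
    linarith
  obtain ⟨η, hη, hη1, hηA⟩ : ∃ η : ℝ, 0 < η ∧ η ≤ 1 / 2 ∧ c * η ^ α ≤ A / 2 := by
    have hα := h.alpha_pos
    have ht : Tendsto (fun η : ℝ => c * η ^ α) (𝓝[>] 0) (𝓝 0) := by
      have := ((Real.continuousAt_rpow_const 0 α (Or.inr hα.le)).const_mul c)
      have h2 : Tendsto (fun η : ℝ => c * η ^ α) (𝓝 0) (𝓝 0) := by
        simpa [ContinuousAt, Real.zero_rpow hα.ne'] using this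
      exact h2.mono_left nhdsWithin_le_nhds
    have h1 := ht.eventually_le_const (half_pos hA)
    have h2 : ∀ᶠ η : ℝ in 𝓝[>] 0, η ≤ 1 / 2 :=
      nhdsWithin_le_nhds (eventually_le_nhds (by norm_num))
    obtain ⟨η, ⟨h3, h4⟩, h5⟩ := ((h1.and h2).and self_mem_nhdsWithin).exists
    exact ⟨η, h5, h4, h3⟩
  refine ⟨η * A / 4, by positivity, fun k j hj hjk => ?_⟩
  set r : ℝ := (2 : ℝ) ^ ((k : ℝ) / 2) with hr
  have hr0 : 0 < r := by positivity
  have hrr : r * r = 2 ^ k := two_rpow_half_sq k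
  have h2k : (1 : ℝ) ≤ 2 ^ k := one_le_pow₀ (by norm_num)
  obtain ⟨t₀, ht₀, hval⟩ := h.exists_le_abs hc hn hj hjk hA hAc
  rw [← hr] at hval
  have hint := h.integrable hc hj hjk
  set d : ℝ := η / 2 ^ k with hd
  have hd0 : 0 < d := by positivity
  have hdη : d ≤ η := div_le_self hη.le h2k
  obtain ⟨p, hp0, hp1, hpt, htp⟩ : ∃ p, 0 ≤ p ∧ p + d ≤ 1 ∧ p ≤ t₀ ∧ t₀ ≤ p + d := by
    rcases le_total t₀ (1 / 2) with hle | hle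
    · exact ⟨t₀, ht₀.1, by linarith, le_rfl, by linarith⟩
    · exact ⟨t₀ - d, by linarith, by linarith [ht₀.2], by linarith, by linarith⟩
  obtain ⟨s, hs1, hs2⟩ : ∃ s : ℝ, |s| = 1 ∧ s * Φ k j t₀ = |Φ k j t₀| := by
    rcases le_total 0 (Φ k j t₀) with h0 | h0
    · exact ⟨1, by simp, by rw [abs_of_nonneg h0, one_mul]⟩
    · exact ⟨-1, by simp, by rw [abs_of_nonpos h0]; ring⟩
  have hlow : ∀ t ∈ Set.Ioc p (p + d), A / 2 * r ≤ s * Φ k j t := by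
    intro t ht
    have hdist : |t₀ - t| ≤ d := by rw [_root_.abs_le]; constructor <;> linarith [ht.1, ht.2]
    have hd1 : d ≤ 1 / 2 ^ k := by rw [hd]; gcongr; linarith
    have h1 := h.holder k j hj hjk t₀ ht₀ t ⟨by linarith [ht.1], by linarith [ht.2]⟩
      (hdist.trans hd1)
    have h2 : ((2 : ℝ) ^ k * |t₀ - t|) ^ α ≤ η ^ α := by
      refine Real.rpow_le_rpow (by positivity) ?_ h.alpha_pos.le
      calc (2 : ℝ) ^ k * |t₀ - t| ≤ 2 ^ k * d := by gcongr
        _ = η := by rw [hd]; field_simp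
    have h3 := waveletWeight_le_one h.beta_pos ((2 : ℝ) ^ k * t₀ - j)
    have h3' := waveletWeight_nonneg β ((2 : ℝ) ^ k * t₀ - j)
    have h4 : |Φ k j t₀ - Φ k j t| ≤ A / 2 * r := by
      calc |Φ k j t₀ - Φ k j t|
          ≤ c * r * ((2 : ℝ) ^ k * |t₀ - t|) ^ α * waveletWeight β ((2 : ℝ) ^ k * t₀ - j) := h1
        _ ≤ c * r * η ^ α * 1 := by gcongr
        _ = c * η ^ α * r := by ring
        _ ≤ A / 2 * r := by gcongr
    have h5 : s * (Φ k j t₀ - Φ k j t) ≤ A / 2 * r := by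
      refine (le_abs_self _).trans ?_
      rwa [abs_mul, hs1, one_mul]
    have h6 : s * Φ k j t = |Φ k j t₀| - s * (Φ k j t₀ - Φ k j t) := by rw [← hs2]; ring
    linarith
  have hsplit : (∫ t in Set.Ioi p, Φ k j t) =
      (∫ t in Set.Ioc p (p + d), Φ k j t) + ∫ t in Set.Ioi (p + d), Φ k j t := by
    have hdisj : Disjoint (Set.Ioc p (p + d)) (Set.Ioi (p + d)) :=
      Set.disjoint_left.2 fun t h1 h2 => not_lt.2 h1.2 h2
    rw [← setIntegral_union hdisj measurableSet_Ioi hint.integrableOn hint.integrableOn,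
      Set.Ioc_union_Ioi_eq_Ioi (by linarith)]
  have hbig : η * A / 2 / r ≤ s * ∫ t in Set.Ioc p (p + d), Φ k j t := by
    rw [← integral_const_mul]
    calc η * A / 2 / r = ∫ t in Set.Ioc p (p + d), A / 2 * r := by
          rw [setIntegral_const, Real.volume_real_Ioc_of_le (by linarith), smul_eq_mul,
            add_sub_cancel_left, hd, ← hrr]
          field_simp
      _ ≤ _ := setIntegral_mono_on (integrableOn_const (by simp)) (hint.const_mul s).integrableOn
          measurableSet_Ioc hlow
  have e : η * A / 2 / r = η * A / 4 / r + η * A / 4 / r := by ring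
  by_cases hcase : η * A / 4 / r ≤ s * ∫ t in Set.Ioi p, Φ k j t
  · exact ⟨p, s, hs1, hcase⟩
  · refine ⟨p + d, -s, by rwa [abs_neg], ?_⟩
    rw [hsplit, mul_add] at hcase
    rw [neg_mul]
    linarith

end IsWaveletTypeSystem

/-! ### The natural ordering -/

namespace IsWaveletTypeSystem

variable {c α β : ℝ} {Φ : ℕ → ℕ → ℝ → ℝ}

lemma naturalOrdering_index {n : ℕ} (hn : 2 ≤ n) :
    1 ≤ n - 2 ^ Nat.log 2 (n - 1) ∧ n - 2 ^ Nat.log 2 (n - 1) ≤ 2 ^ Nat.log 2 (n - 1) := by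
  have h1 := Nat.pow_log_le_self 2 (x := n - 1) (by omega)
  have h2 := Nat.lt_pow_succ_log_self (b := 2) (by norm_num) (n - 1)
  rw [pow_succ] at h2
  omega

lemma integrable_naturalOrdering (h : IsWaveletTypeSystem c α β Φ) (hc : 0 < c) {n : ℕ}
    (hn : 2 ≤ n) : Integrable (naturalOrdering Φ n) :=
  h.integrable hc (naturalOrdering_index hn).1 (naturalOrdering_index hn).2

lemma integral_abs_naturalOrdering_le (h : IsWaveletTypeSystem c α β Φ) (hc : 0 < c) {n : ℕ}
    (hn : 2 ≤ n) :
    ∫ t, |naturalOrdering Φ n t| ≤ 2 * c * (∫ t, waveletWeight β t) / √n := by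
  have h1 := h.integral_abs_le hc (naturalOrdering_index hn).1 (naturalOrdering_index hn).2
  refine h1.trans ?_
  set k := Nat.log 2 (n - 1)
  have hI : 0 ≤ ∫ t, waveletWeight β t := integral_nonneg fun t => waveletWeight_nonneg β t
  have hn1 : (n : ℝ) ≤ 2 ^ k * 2 := by
    have := Nat.lt_pow_succ_log_self (b := 2) (by norm_num) (n - 1)
    have h3 : n ≤ 2 ^ k * 2 := by
      rw [pow_succ] at this
      change n - 1 < 2 ^ k * 2 at this
      omega
    exact_mod_cast h3
  have hr : (0 : ℝ) < (2 : ℝ) ^ ((k : ℝ) / 2) := by positivity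
  have hsq : √(n : ℝ) ≤ 2 * (2 : ℝ) ^ ((k : ℝ) / 2) := by
    refine Real.sqrt_le_iff.2 ⟨by positivity, ?_⟩
    have := two_rpow_half_sq k
    have h2k : (0 : ℝ) < 2 ^ k := by positivity
    nlinarith
  have hn0 : 0 < √(n : ℝ) := Real.sqrt_pos.2 (by exact_mod_cast (by omega : 0 < n))
  rw [div_le_div_iff₀ hr hn0]
  have : 0 ≤ c * ∫ t, waveletWeight β t := by positivity
  nlinarith

end IsWaveletTypeSystem

/-- The indices `n` with `n + 2 = 2 ^ k + j` and `1 ≤ j ≤ 2 ^ k` for a level `N ≤ k < N'` form one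
interval, which splits according to the level. -/
lemma sum_Ico_two_pow_sub_one (f : ℕ → ℝ) {N N' : ℕ} (h : N ≤ N') :
    ∑ n ∈ Finset.Ico (2 ^ N - 1) (2 ^ N' - 1), f n =
      ∑ k ∈ Finset.Ico N N', ∑ m ∈ Finset.range (2 ^ k), f (2 ^ k - 1 + m) := by
  induction N', h using Nat.le_induction with
  | base => simp
  | succ K hK ih =>
    have h1 : 2 ^ N - 1 ≤ 2 ^ K - 1 :=
      Nat.sub_le_sub_right (Nat.pow_le_pow_right (by norm_num) hK) 1
    have h2 : 2 ^ K - 1 ≤ 2 ^ (K + 1) - 1 :=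
      Nat.sub_le_sub_right (Nat.pow_le_pow_right (by norm_num) (Nat.le_succ K)) 1
    have h3 : 2 ^ (K + 1) - 1 - (2 ^ K - 1) = 2 ^ K := by
      have := Nat.one_le_two_pow (n := K)
      rw [pow_succ]; omega
    rw [Finset.sum_Ico_succ_top hK, ← Finset.sum_Ico_consecutive f h1 h2, ih,
      Finset.sum_Ico_eq_sum_range f (2 ^ K - 1), h3]

lemma log_two_pow_sub_one_add {k m : ℕ} (hm : m < 2 ^ k) :
    Nat.log 2 (2 ^ k - 1 + m + 1) = k := by
  have := Nat.one_le_two_pow (n := k)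
  exact Nat.log_eq_of_pow_le_of_lt_pow (by omega) (by rw [pow_succ]; omega)

lemma naturalOrdering_two_pow_sub_one_add (Φ : ℕ → ℕ → ℝ → ℝ) {k m : ℕ} (hm : m < 2 ^ k) :
    naturalOrdering Φ (2 ^ k - 1 + m + 2) = Φ k (m + 1) := by
  have := Nat.one_le_two_pow (n := k)
  rw [show 2 ^ k - 1 + m + 2 = 2 ^ k + (m + 1) by omega]
  exact naturalOrdering_two_pow_add Φ k (m + 1) (by omega) (by omega)

namespace IsWaveletTypeSystem

variable {c α β : ℝ} {Φ : ℕ → ℕ → ℝ → ℝ}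

/-! ### Sufficiency of the condition on the multiplier -/

/-- The series converges absolutely almost everywhere: `‖φ n‖₁` is of order `n ^ (-1 / 2)`, and
`|a n| * n ^ (-1 / 2) ≤ a n ^ 2 * w n + 1 / (n * w n)`. -/
theorem isUCMultiplier_of_summable (h : IsWaveletTypeSystem c α β Φ) (hc : 0 < c) {w : ℕ → ℝ}
    (hpos : ∀ n : ℕ, 1 ≤ n → 0 < w n)
    (hsum : Summable (fun n : ℕ => 1 / (((n + 1 : ℕ) : ℝ) * w (n + 1)))) :
    IsUCMultiplier (Set.Ici 2) (Set.Ioo 0 1) (naturalOrdering Φ) w := by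
  intro a ha σ
  refine ae_restrict_of_ae ?_
  have hσ : ∀ i, 2 ≤ (σ i : ℕ) := fun i => (σ i).2
  have hinj : Function.Injective (fun i => (σ i : ℕ)) :=
    Subtype.val_injective.comp σ.injective
  have hs1 : Summable (fun i => a (σ i) ^ 2 * w (σ i)) := ha.comp_injective σ.injective
  have hs2 : Summable (fun i => 1 / (((σ i : ℕ) : ℝ) * w (σ i))) :=
    ((summable_nat_add_iff (f := fun n : ℕ => 1 / ((n : ℝ) * w n)) 1).1 hsum).comp_injective hinj
  set D : ℝ := 2 * c * ∫ t, waveletWeight β t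
  have hD : 0 ≤ D :=
    mul_nonneg (by positivity) (integral_nonneg fun t => waveletWeight_nonneg β t)
  have hint : ∀ i, Integrable (fun x => a (σ i) * naturalOrdering Φ (σ i) x) := fun i =>
    (h.integrable_naturalOrdering hc (hσ i)).const_mul _
  have hbound : ∀ i, ∫ x, ‖a (σ i) * naturalOrdering Φ (σ i) x‖ ≤
      D * (a (σ i) ^ 2 * w (σ i) + 1 / (((σ i : ℕ) : ℝ) * w (σ i))) := by
    intro i
    have hw := hpos (σ i) (by have := hσ i; omega)
    have hn : (0 : ℝ) < ((σ i : ℕ) : ℝ) := by exact_mod_cast (by have := hσ i; omega)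
    have hsn := Real.sqrt_pos.2 hn
    have hsw := Real.sqrt_pos.2 hw
    simp only [norm_mul, Real.norm_eq_abs]
    rw [integral_const_mul]
    calc |a (σ i)| * ∫ x, |naturalOrdering Φ (σ i) x|
        ≤ |a (σ i)| * (D / √(σ i : ℕ)) := by
          gcongr
          exact h.integral_abs_naturalOrdering_le hc (hσ i)
      _ = D * ((|a (σ i)| * √(w (σ i))) * (1 / (√(σ i : ℕ) * √(w (σ i))))) := by
          field_simp
      _ ≤ D * ((|a (σ i)| * √(w (σ i))) ^ 2 + (1 / (√(σ i : ℕ) * √(w (σ i)))) ^ 2) := by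
          gcongr
          have p : 0 ≤ |a (σ i)| * √(w (σ i)) := by positivity
          have q : 0 ≤ 1 / (√(σ i : ℕ) * √(w (σ i))) := by positivity
          nlinarith [sq_nonneg (|a (σ i)| * √(w (σ i)) - 1 / (√(σ i : ℕ) * √(w (σ i)))),
            mul_nonneg p q]
      _ = _ := by
          rw [mul_pow, div_pow, mul_pow, sq_abs, Real.sq_sqrt hw.le, Real.sq_sqrt hn.le, one_pow]
  have hL1 : Summable (fun i => ∫ x, ‖a (σ i) * naturalOrdering Φ (σ i) x‖) :=
    Summable.of_nonneg_of_le (fun i => integral_nonneg fun x => norm_nonneg _) hbound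
      ((hs1.add hs2).mul_left D)
  have hfin : ∑' i, eLpNorm (fun x => a (σ i) * naturalOrdering Φ (σ i) x) 1 volume ≠ ⊤ := by
    simp_rw [eLpNorm_one_eq_lintegral_enorm, ← ofReal_integral_norm_eq_lintegral_enorm (hint _)]
    exact hL1.tsum_ofReal_ne_top
  have hae := summable_norm_of_tsum_eLpNorm_ne_top le_rfl (fun i => (hint i).1) hfin
  filter_upwards [hae] with x hx
  exact ⟨_, hx.of_norm.hasSum.tendsto_sum_nat⟩

end IsWaveletTypeSystem

/-! ### Necessity of the condition on the multiplier -/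

namespace IsWaveletTypeSystem

variable {c α β : ℝ} {Φ : ℕ → ℕ → ℝ → ℝ}

lemma exists_sum_abs_le (h : IsWaveletTypeSystem c α β Φ) (hc : 0 < c) :
    ∃ C : ℝ, 0 < C ∧ ∀ (k : ℕ) (x : ℝ),
      ∑ m ∈ Finset.range (2 ^ k), |Φ k (m + 1) x| ≤ C * (2 : ℝ) ^ ((k : ℝ) / 2) := by
  obtain ⟨C, hC, hb⟩ := exists_sum_waveletWeight_le h.beta_pos
  refine ⟨c * C, by positivity, fun k x => ?_⟩
  calc ∑ m ∈ Finset.range (2 ^ k), |Φ k (m + 1) x|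
      ≤ ∑ m ∈ Finset.range (2 ^ k), c * (2 : ℝ) ^ ((k : ℝ) / 2) *
          waveletWeight β ((2 : ℝ) ^ k * x - (m + 1 : ℕ)) :=
        Finset.sum_le_sum fun m hm => h.abs_le_univ hc (by omega)
          (Nat.succ_le_of_lt (Finset.mem_range.1 hm)) x
    _ = c * (2 : ℝ) ^ ((k : ℝ) / 2) * ∑ m ∈ Finset.range (2 ^ k),
          waveletWeight β ((2 : ℝ) ^ k * x - (m + 1 : ℕ)) := by rw [Finset.mul_sum]
    _ ≤ c * (2 : ℝ) ^ ((k : ℝ) / 2) * C := by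
        gcongr
        exact hb _ _
    _ = c * C * (2 : ℝ) ^ ((k : ℝ) / 2) := by ring

/-- All functions of the system vanish outside `[0, 1]`, so the half-line integrals may be taken
over `(0, 1)`. -/
lemma integral_indicator_Ioi (h : IsWaveletTypeSystem c α β Φ) {k j : ℕ} (hj : 1 ≤ j)
    (hjk : j ≤ 2 ^ k) (y : ℝ) :
    ∫ t in Set.Ioo (0 : ℝ) 1, (Set.Ioi y).indicator (Φ k j) t = ∫ t in Set.Ioi y, Φ k j t := by
  rw [← integral_Icc_eq_integral_Ioo, ← integral_indicator measurableSet_Ioi]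
  refine setIntegral_eq_integral_of_forall_compl_eq_zero fun t ht => ?_
  have h0 : Φ k j t = 0 := by
    by_contra h1
    exact ht (h.support_subset k j hj hjk h1)
  rw [Set.indicator_apply, h0, ite_self]

end IsWaveletTypeSystem

/-- Condensation: if `∑ 1 / (n w n)` diverges, so does `∑ 1 / w (2 ^ (k + 1))`, where
`w (2 ^ (k + 1))` is the largest weight on the level `k`. -/
lemma not_summable_one_div_two_pow {w : ℕ → ℝ} (hpos : ∀ n : ℕ, 1 ≤ n → 0 < w n)
    (hmono : ∀ m n : ℕ, 1 ≤ m → m ≤ n → w m ≤ w n)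
    (hns : ¬ Summable (fun n : ℕ => 1 / (((n + 1 : ℕ) : ℝ) * w (n + 1)))) :
    ¬ Summable (fun k : ℕ => 1 / w (2 ^ (k + 1))) := by
  intro hs
  refine hns ((summable_nat_add_iff (f := fun n : ℕ => 1 / ((n : ℝ) * w n)) 1).2 ?_)
  rw [← summable_condensed_iff_of_nonneg]
  · refine ((summable_nat_add_iff (f := fun k : ℕ => 1 / w (2 ^ k)) 1).1 hs).congr fun k => ?_
    have := hpos (2 ^ k) Nat.one_le_two_pow
    push_cast
    field_simp
  · intro n
    rcases Nat.eq_zero_or_pos n with rfl | hn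
    · simp
    · have := hpos n hn
      positivity
  · intro m n hm hmn
    have := hpos m hm
    have := hmono m n hm hmn
    have : (0 : ℝ) < m := by exact_mod_cast hm
    gcongr

/-- A sequence of levels cutting a series into blocks of sum at least `1 / 2`. -/
lemma exists_strictMono_block_sum_ge {b : ℕ → ℝ}
    (hb : ∀ m, ∃ n, m < n ∧ 1 / 2 ≤ ∑ k ∈ Finset.Ico m n, b k) :
    ∃ N : ℕ → ℕ, StrictMono N ∧ N 0 = 0 ∧
      ∀ i, 1 / 2 ≤ ∑ k ∈ Finset.Ico (N i) (N (i + 1)), b k := by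
  choose g hg1 hg2 using hb
  refine ⟨fun i => g^[i] 0, strictMono_nat_of_lt_succ fun i => ?_, rfl, fun i => ?_⟩
  · simp only [Function.iterate_succ_apply']
    exact hg1 _
  · simp only [Function.iterate_succ_apply']
    exact hg2 _

/-- The shift `n ↦ n + 2`, as an enumeration of the index set of the system. -/
def shiftEquiv : ℕ ≃ Set.Ici 2 where
  toFun n := ⟨n + 2, Nat.le_add_left 2 n⟩
  invFun n := n - 2
  left_inv n := by simp
  right_inv n := Subtype.ext (Nat.sub_add_cancel n.2)

namespace IsWaveletTypeSystem

variable {c α β : ℝ} {Φ : ℕ → ℕ → ℝ → ℝ}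

/-- If `∑ 1 / (n w n)` diverges, a series with coefficients of modulus `b k * 2 ^ (-k / 2)` on
level `k` and a suitable rearrangement of it violate the multiplier property. -/
theorem summable_of_isUCMultiplier (h : IsWaveletTypeSystem c α β Φ) (hc : 0 < c)
    (hnorm : IsL2Normalized Φ) {w : ℕ → ℝ} (hpos : ∀ n : ℕ, 1 ≤ n → 0 < w n)
    (hmono : ∀ m n : ℕ, 1 ≤ m → m ≤ n → w m ≤ w n)
    (hUC : IsUCMultiplier (Set.Ici 2) (Set.Ioo 0 1) (naturalOrdering Φ) w) :
    Summable (fun n : ℕ => 1 / (((n + 1 : ℕ) : ℝ) * w (n + 1))) := by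
  by_contra hns
  obtain ⟨b, hb0, hbw, hbd⟩ := exists_weighted_square_summable_of_not_summable
    (fun k => one_div_pos.2 (hpos (2 ^ (k + 1)) Nat.one_le_two_pow))
    (not_summable_one_div_two_pow hpos hmono hns)
  obtain ⟨N, hN, hN0, hNb⟩ := exists_strictMono_block_sum_ge hbd
  obtain ⟨κ, hκ, hys⟩ := h.exists_le_integral_Ioi hc hnorm
  obtain ⟨C, hC, hCb⟩ := h.exists_sum_abs_le hc
  have hys' : ∀ k m : ℕ, ∃ y s : ℝ, |s| = 1 ∧ (m < 2 ^ k →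
      κ / (2 : ℝ) ^ ((k : ℝ) / 2) ≤ s * ∫ t in Set.Ioi y, Φ k (m + 1) t) := by
    intro k m
    by_cases hm : m < 2 ^ k
    · obtain ⟨y, s, h1, h2⟩ := hys k (m + 1) (by omega) hm
      exact ⟨y, s, h1, fun _ => h2⟩
    · exact ⟨0, 1, abs_one, fun hlt => absurd hlt hm⟩
  choose y s hs hsy using hys'
  -- `lev n` and `pos n` locate the function with natural number `n + 2` in the double array.
  let lev : ℕ → ℕ := fun n => Nat.log 2 (n + 1)
  let pos : ℕ → ℕ := fun n => n - (2 ^ lev n - 1)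
  let Y : ℕ → ℝ := fun n => y (lev n) (pos n)
  let A : ℕ → ℝ := fun n => s (lev n) (pos n) * (b (lev n) / (2 : ℝ) ^ ((lev n : ℝ) / 2))
  have hlev : ∀ {k m : ℕ}, m < 2 ^ k → lev (2 ^ k - 1 + m) = k := fun hm =>
    log_two_pow_sub_one_add hm
  have hY : ∀ {k m : ℕ}, m < 2 ^ k → Y (2 ^ k - 1 + m) = y k m := by
    intro k m hm
    simp only [Y, pos, hlev hm, Nat.add_sub_cancel_left]
  have hA : ∀ {k m : ℕ}, m < 2 ^ k →
      A (2 ^ k - 1 + m) = s k m * (b k / (2 : ℝ) ^ ((k : ℝ) / 2)) := by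
    intro k m hm
    simp only [A, pos, hlev hm, Nat.add_sub_cancel_left]
  let M : ℕ → ℕ := fun i => 2 ^ N i - 1
  have hM : StrictMono M := fun i j hij => by
    have h1 := Nat.pow_lt_pow_right (a := 2) (by norm_num) (hN hij)
    have h2 := Nat.one_le_two_pow (n := N i)
    show 2 ^ N i - 1 < 2 ^ N j - 1
    omega
  have hM0 : M 0 = 0 := by simp [M, hN0]
  obtain ⟨τ, hτ⟩ := exists_perm_monotone_on_blocks hM hM0 Y
  let a : ℕ → ℝ := fun n => A (n - 2)
  have ha : Summable (fun n : Set.Ici 2 => a n ^ 2 * w n) := by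
    rw [← shiftEquiv.summable_iff]
    show Summable (fun n : ℕ => A n ^ 2 * w (n + 2))
    have hnn : ∀ n : ℕ, 0 ≤ A n ^ 2 * w (n + 2) := fun n =>
      mul_nonneg (sq_nonneg _) (hpos _ (by omega)).le
    refine summable_of_sum_range_le (c := ∑' k, b k ^ 2 / (1 / w (2 ^ (k + 1)))) hnn fun K => ?_
    have hK : K ≤ 2 ^ K - 1 := Nat.le_sub_one_of_lt Nat.lt_two_pow_self
    calc ∑ n ∈ Finset.range K, A n ^ 2 * w (n + 2)
        ≤ ∑ n ∈ Finset.range (2 ^ K - 1), A n ^ 2 * w (n + 2) :=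
          Finset.sum_le_sum_of_subset_of_nonneg (Finset.range_subset_range.2 hK)
            fun n _ _ => hnn n
      _ = ∑ k ∈ Finset.Ico 0 K, ∑ m ∈ Finset.range (2 ^ k),
            A (2 ^ k - 1 + m) ^ 2 * w (2 ^ k - 1 + m + 2) := by
          rw [← sum_Ico_two_pow_sub_one (fun n => A n ^ 2 * w (n + 2)) (Nat.zero_le K),
            pow_zero, Nat.sub_self, Finset.range_eq_Ico]
      _ ≤ ∑ k ∈ Finset.Ico 0 K, b k ^ 2 / (1 / w (2 ^ (k + 1))) := by
          refine Finset.sum_le_sum fun k _ => ?_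
          have hterm : ∀ m ∈ Finset.range (2 ^ k),
              A (2 ^ k - 1 + m) ^ 2 * w (2 ^ k - 1 + m + 2) ≤
                b k ^ 2 / 2 ^ k * w (2 ^ (k + 1)) := by
            intro m hm
            have hm' := Finset.mem_range.1 hm
            have h1 := Nat.one_le_two_pow (n := k)
            rw [hA hm', mul_pow, ← sq_abs (s k m), hs, one_pow, one_mul, div_pow,
              sq ((2 : ℝ) ^ ((k : ℝ) / 2)), two_rpow_half_sq]
            gcongr
            exact hmono _ _ (by omega) (by rw [pow_succ]; omega)
          refine (Finset.sum_le_card_nsmul _ _ _ hterm).trans (le_of_eq ?_)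
          rw [Finset.card_range, nsmul_eq_mul]
          push_cast
          field_simp
      _ ≤ _ := by
          refine hbw.sum_le_tsum _ fun k _ => ?_
          have := hpos (2 ^ (k + 1)) Nat.one_le_two_pow
          positivity
  have hconv := hUC a ha (τ.trans shiftEquiv)
  -- By the choice of `τ`, the functions `T i` are differences of partial sums of the rearranged
  -- series.
  let T : ℕ → ℝ → ℝ := fun i x => ∑ n ∈ Finset.Ico (M i) (M (i + 1)),
    A n * (Set.Ioi (Y n)).indicator (naturalOrdering Φ (n + 2)) x
  let S : ℕ → ℝ := fun i => ∑ k ∈ Finset.Ico (N i) (N (i + 1)), b k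
  have hS : ∀ i, 0 < S i := fun i => lt_of_lt_of_le (by norm_num) (hNb i)
  have hTlev : ∀ i x, T i x = ∑ k ∈ Finset.Ico (N i) (N (i + 1)), ∑ m ∈ Finset.range (2 ^ k),
      s k m * (b k / (2 : ℝ) ^ ((k : ℝ) / 2)) *
        (Set.Ioi (y k m)).indicator (Φ k (m + 1)) x := by
    intro i x
    refine (sum_Ico_two_pow_sub_one _ (hN (Nat.lt_succ_self i)).le).trans ?_
    refine Finset.sum_congr rfl fun k _ => Finset.sum_congr rfl fun m hm => ?_
    have hm' := Finset.mem_range.1 hm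
    rw [hA hm', hY hm', naturalOrdering_two_pow_sub_one_add Φ hm']
  have hTle : ∀ i x, |T i x| ≤ C * S i := by
    intro i x
    rw [hTlev, Finset.mul_sum]
    refine (Finset.abs_sum_le_sum_abs _ _).trans (Finset.sum_le_sum fun k _ => ?_)
    have hr : (0 : ℝ) < (2 : ℝ) ^ ((k : ℝ) / 2) := by positivity
    have hbk := hb0 k
    calc |∑ m ∈ Finset.range (2 ^ k), s k m * (b k / (2 : ℝ) ^ ((k : ℝ) / 2)) *
            (Set.Ioi (y k m)).indicator (Φ k (m + 1)) x|
        ≤ ∑ m ∈ Finset.range (2 ^ k), b k / (2 : ℝ) ^ ((k : ℝ) / 2) * |Φ k (m + 1) x| := by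
          refine (Finset.abs_sum_le_sum_abs _ _).trans (Finset.sum_le_sum fun m _ => ?_)
          rw [abs_mul, abs_mul, hs, one_mul, abs_of_pos (div_pos hbk hr)]
          refine mul_le_mul_of_nonneg_left ?_ (div_pos hbk hr).le
          rw [Set.indicator_apply]
          split_ifs
          · exact le_rfl
          · rw [abs_zero]; exact abs_nonneg _
      _ ≤ b k / (2 : ℝ) ^ ((k : ℝ) / 2) * (C * (2 : ℝ) ^ ((k : ℝ) / 2)) := by
          rw [← Finset.mul_sum]
          gcongr
          exact hCb k x
      _ = C * b k := by field_simp
  have hindint : ∀ {k m : ℕ}, m < 2 ^ k →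
      Integrable ((Set.Ioi (y k m)).indicator (Φ k (m + 1)))
        (volume.restrict (Set.Ioo (0 : ℝ) 1)) := fun hm =>
    ((h.integrable hc (by omega) hm).indicator measurableSet_Ioi).restrict
  -- Here the signs `s` and the cut-offs `y` enter: each of the `2 ^ k` functions of level `k`
  -- contributes at least `κ * b k / 2 ^ k`.
  have hTint : ∀ i, κ * S i ≤ ∫ x in Set.Ioo (0 : ℝ) 1, T i x := by
    intro i
    simp_rw [hTlev]
    rw [integral_finsetSum _ fun k _ => integrable_finsetSum _ fun m hm =>
      (hindint (Finset.mem_range.1 hm)).const_mul _, Finset.mul_sum]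
    refine Finset.sum_le_sum fun k _ => ?_
    rw [integral_finsetSum _ fun m hm => (hindint (Finset.mem_range.1 hm)).const_mul _]
    have hr : (0 : ℝ) < (2 : ℝ) ^ ((k : ℝ) / 2) := by positivity
    have hbk := hb0 k
    have hterm : ∀ m ∈ Finset.range (2 ^ k), κ * b k / 2 ^ k ≤
        ∫ x in Set.Ioo (0 : ℝ) 1, s k m * (b k / (2 : ℝ) ^ ((k : ℝ) / 2)) *
          (Set.Ioi (y k m)).indicator (Φ k (m + 1)) x := by
      intro m hm
      have hm' := Finset.mem_range.1 hm
      rw [integral_const_mul, h.integral_indicator_Ioi (by omega) hm']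
      calc κ * b k / 2 ^ k = b k / (2 : ℝ) ^ ((k : ℝ) / 2) * (κ / (2 : ℝ) ^ ((k : ℝ) / 2)) := by
            rw [← two_rpow_half_sq]; field_simp
        _ ≤ b k / (2 : ℝ) ^ ((k : ℝ) / 2) *
              (s k m * ∫ t in Set.Ioi (y k m), Φ k (m + 1) t) := by
            gcongr
            exact hsy k m hm'
        _ = _ := by ring
    refine (le_of_eq ?_).trans (Finset.card_nsmul_le_sum _ _ _ hterm)
    rw [Finset.card_range, nsmul_eq_mul]
    push_cast
    field_simp
  have hTmeas : ∀ i, AEStronglyMeasurable (T i) (volume.restrict (Set.Ioo (0 : ℝ) 1)) := by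
    intro i
    have : T i = fun x => ∑ k ∈ Finset.Ico (N i) (N (i + 1)), ∑ m ∈ Finset.range (2 ^ k),
        s k m * (b k / (2 : ℝ) ^ ((k : ℝ) / 2)) *
          (Set.Ioi (y k m)).indicator (Φ k (m + 1)) x := funext fun x => hTlev i x
    rw [this]
    exact (integrable_finsetSum _ fun k _ => integrable_finsetSum _ fun m hm =>
      (hindint (Finset.mem_range.1 hm)).const_mul _).1
  have hT0 : ∀ᵐ x ∂(volume.restrict (Set.Ioo (0 : ℝ) 1)),
      Tendsto (fun i => T i x / S i) atTop (𝓝 0) := by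
    filter_upwards [hconv] with x hx
    obtain ⟨L, hL⟩ := hx
    have hMtop := hM.tendsto_atTop
    choose p hp1 hp2 using fun i => exists_sum_Ico_comp_eq_sum_filter
      (hM (Nat.lt_succ_self i)).le (hτ i).1 (hτ i).2 x
      (fun n => A n * naturalOrdering Φ (n + 2) x)
    have hTp : ∀ i, T i x =
        (∑ n ∈ Finset.range (p i), A (τ n) * naturalOrdering Φ (τ n + 2) x) -
          ∑ n ∈ Finset.range (M i), A (τ n) * naturalOrdering Φ (τ n + 2) x := by
      intro i
      rw [← Finset.sum_Ico_eq_sub _ (hp1 i), hp2 i]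
      refine Finset.sum_congr rfl fun n _ => ?_
      rw [Set.indicator_apply, mul_ite, mul_zero]
      rfl
    have hL' : Tendsto (fun K => ∑ n ∈ Finset.range K,
        A (τ n) * naturalOrdering Φ (τ n + 2) x) atTop (𝓝 L) := hL
    have hTt : Tendsto (fun i => T i x) atTop (𝓝 0) := by
      simp_rw [hTp]
      have := (hL'.comp (tendsto_atTop_mono hp1 hMtop)).sub (hL'.comp hMtop)
      rwa [sub_self] at this
    refine squeeze_zero_norm (fun i => ?_) (by simpa using (hTt.norm.const_mul 2))
    rw [norm_div, Real.norm_of_nonneg (hS i).le, div_le_iff₀ (hS i)]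
    have := hNb i
    have h3 : 1 ≤ 2 * S i := by simp only [S]; linarith
    nlinarith [mul_le_mul_of_nonneg_right h3 (norm_nonneg (T i x)), Real.norm_eq_abs (T i x)]
  -- Bounded convergence on `(0, 1)` contradicts the lower bound for the integrals.
  have hlim := tendsto_integral_filter_of_norm_le_const
    (l := atTop) (F := fun i x => T i x / S i) (f := fun _ => (0 : ℝ))
    (μ := volume.restrict (Set.Ioo (0 : ℝ) 1))
    (Eventually.of_forall fun i => by
      simpa only [div_eq_mul_inv] using (hTmeas i).mul_const (S i)⁻¹)
    ⟨C, Eventually.of_forall fun i => Eventually.of_forall fun x => by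
      rw [norm_div, Real.norm_of_nonneg (hS i).le, div_le_iff₀ (hS i)]
      exact hTle i x⟩ hT0
  rw [integral_zero] at hlim
  have hge : ∀ i, κ ≤ ∫ x in Set.Ioo (0 : ℝ) 1, T i x / S i := by
    intro i
    rw [integral_div, le_div_iff₀ (hS i)]
    exact hTint i
  exact absurd (ge_of_tendsto' hlim hge) (not_le.2 hκ)

end IsWaveletTypeSystem

theorem corollary1 (c α β : ℝ) (Φ : ℕ → ℕ → ℝ → ℝ)
    (hΦ : IsWaveletTypeSystem c α β Φ) (hnorm : IsL2Normalized Φ)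
    (w : ℕ → ℝ) (hpos : ∀ n : ℕ, 1 ≤ n → 0 < w n)
    (hmono : ∀ m n : ℕ, 1 ≤ m → m ≤ n → w m ≤ w n) :
    IsUCMultiplier (Set.Ici 2) (Set.Ioo 0 1) (naturalOrdering Φ) w ↔
      Summable (fun n : ℕ => 1 / (((n + 1 : ℕ) : ℝ) * w (n + 1))) := by
  -- Enlarging `c` makes it positive without discussing the sign of the given constant.
  have h := hΦ.mono_const (le_max_left c 1)
  have hc : 0 < max c 1 := lt_max_of_lt_right one_pos
  exact ⟨h.summable_of_isUCMultiplier hc hnorm hpos hmono,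
    h.isUCMultiplier_of_summable hc hpos⟩
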